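/- **Setting.** Consider the noisy control system $x_{t+1}=f(x_t,u_t+\zeta_t,w_t)$ with $f:\mathbb R^d\times\mathbb R^m\times\mathbb R^p\to\mathbb R^d$ continuous and $f(0,0,0)=0$. Let $\mathbb M\subset\mathbb R^d$ be closed, let $\mathbb U\subset\mathbb R^m$, $\mathbb W\subset\mathbb R^p$, $\mathbb V\subset\mathbb R^m$ and $\mathbb M_F\subset\mathbb R^d$ be compact, each of the five sets containing the origin in its interior ($\mathbb V$ is the set of control approximation errors, e.g. a closed ball whose radius is the prescribed error margin). Let $N\ge1$, let $c:\mathbb R^d\times\mathbb R^m\to[0,\infty)$ and $c_F:\mathbb R^d\to[0,\infty)$ satisfy $c(0,0)=0$ and $c_F(0)=0$, and let $\Pi$ be a class of sequences $\pi=(\pi_t)_{t=0}^{N-1}$ of measurable maps $\pi_t:\mathbb M\to\mathbb U$. The approximation-ready robust problem with initial state $\bar x$ is $$\inf_{\pi\in\Pi}\ \sup_{(w_t,\zeta_t)_{t<N}\in(\mathbb W\times\mathbb V)^N}\ \sum_{t=0}^{N-1}c(x_t,u_t)+c_F(x_N),\qquad x_0=\bar x,\quad u_t=\pi_t(x_t),\quad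 x_{t+1}=f(x_t,u_t+\zeta_t,w_t),$$ subject to $x_t\in\mathbb M$ and $u_t+\zeta_t\in\mathbb U$ for $0\le t\le N-1$, and $x_N\in\mathbb M_F$, for all $(w_t,\zeta_t)_{t<N}\in(\mathbb W\times\mathbb V)^N$. Let $X_N$ be the set of feasible $\bar x$ for which the problem has a solution (a feasible policy of minimal worst-case cost). For $h>0$ put $\widehat X_N(h)=X_N\cap h\mathbb Z^d$. For $\mu:X_N\to\mathbb R^m$ and $L_0\ge0$ the extended map is defined component-wise by $$\mu_E(x)=\inf_{y\in\widehat X_N(h)}\bigl(\mu(y)+L_0\|x-y\|_2\bigr),\qquad x\in\mathbb R^d .$$ A generating function of order $M$ with decay exponent $K>d$ is a real-valued $\psi\in\mathcal S(\mathbb R^d)$ with $\int\psi=1$, with $\int y^\alpha\psi(y)\,dy=0$ for all multi-indices $\alpha$ with $1\le[\alpha]<M$, and with $\sup_x(1+\|x\|)^K|\partial^\alpha\psi(x)|<\infty$ for all $\alpha$ with $[\alpha]\le\lfloor d/2\rfloor+1$. **Theorem 4.2 (a).** Assume that 1. $X_N$ is nonempty and for each $\bar x\in X_N$ the problem has a unique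 solution (it suffices that all solutions at $\bar x$ have the same first control $\pi_0(\bar x)$); let $\mu_0^\star(\bar x)=\pi_0(\bar x)$ be the first control of the solution at $\bar x$; 2. the grid points in $X_N$ form arbitrarily fine nets of $X_N$: for every $\delta>0$ there is $h\in(0,\delta)$ such that every $x\in X_N$ satisfies $\|x-y\|\le\delta$ for some $y\in\widehat X_N(h)$; 3. $\mu_0^\star:X_N\to\mathbb U$ is Lipschitz continuous with constant $L_0$. Then for every $\varepsilon>0$, every $M\in\mathbb N$ and every $K>d$ there are a generating function $\psi\in\mathcal S(\mathbb R^d)$ of order $M$ with decay exponent $K$, a pair $(h,\mathcal D)\in(0,\infty)^2$ and $R_0>0$ such that $\widehat X_N(h)\neq\emptyset$ and the map $$\mu^\dagger(x)=\mathcal D^{-d/2}\sum_{y\in h\mathbb Z^d,\ \|x-y\|\le R_0h}\mu_E(y)\,\psi\Bigl(\frac{x-y}{h\sqrt{\mathcal D}}\Bigr),$$ where $\mu_E$ is the extension with constant $L_0$ of $\mu=\mu_0^\star$ from $\widehat X_N(h)$, satisfies $\mu^\dagger(x)\in\mathbb U$ and $$\|\mu_0^\star(x)-\mu^\dagger(x)\|\le\varepsilon\qquad\text{for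 all }x\in X_N .$$ -/

import Mathlib

open scoped NNReal ENNReal SchwartzMap

noncomputable section

namespace QuIFS

/-- `ℝⁿ` with its standard inner product. -/
abbrev Eucl (n : ℕ) : Type := EuclideanSpace ℝ (Fin n)

/-! ### The approximation-ready robust min-max optimal control problem -/

/-- The data of the approximation-ready robust optimal control problem, for the noisy system
`x_{t+1} = f (x_t, u_t + ζ_t, w_t)` with states in `ℝᵈ`, controls in `ℝᵐ` and disturbances in `ℝᵖ`.

A policy is a sequence of `N` maps from the state set to the control set; each of them is
represented by a total map `ℝᵈ → ℝᵐ` of which only the restriction to `stateSet` is constrained. -/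
structure MPCData (d m p : ℕ) where
  /-- the vector field `f` -/
  field : Eucl d → Eucl m → Eucl p → Eucl d
  field_continuous : Continuous fun q : Eucl d × Eucl m × Eucl p => field q.1 q.2.1 q.2.2
  field_zero : field 0 0 0 = 0
  /-- the state constraint set -/
  stateSet : Set (Eucl d)
  stateSet_closed : IsClosed stateSet
  zero_mem_stateSet : (0 : Eucl d) ∈ interior stateSet
  /-- the control constraint set -/
  controlSet : Set (Eucl m)
  controlSet_compact : IsCompact controlSet
  zero_mem_controlSet : (0 : Eucl m) ∈ interior controlSet
  /-- the set of the exogenous disturbances `w_t` -/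
  distSet : Set (Eucl p)
  distSet_compact : IsCompact distSet
  zero_mem_distSet : (0 : Eucl p) ∈ interior distSet
  /-- the set of the approximation errors `ζ_t` that enter through the control channel,
  e.g. a closed ball around the origin whose radius is the prescribed error margin -/
  errSet : Set (Eucl m)
  errSet_compact : IsCompact errSet
  zero_mem_errSet : (0 : Eucl m) ∈ interior errSet
  /-- the horizon -/
  N : ℕ
  N_pos : 0 < N
  /-- the cost per stage -/
  cost : Eucl d → Eucl m → ℝ≥0
  cost_zero : cost 0 0 = 0
  /-- the final-stage cost -/
  finalCost : Eucl d → ℝ≥0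
  finalCost_zero : finalCost 0 = 0
  /-- the terminal set -/
  terminalSet : Set (Eucl d)
  terminalSet_compact : IsCompact terminalSet
  zero_mem_terminalSet : (0 : Eucl d) ∈ interior terminalSet
  /-- the class of admissible policies -/
  policies : Set (Fin N → Eucl d → Eucl m)
  policies_mapsTo : ∀ π ∈ policies, ∀ t, Set.MapsTo (π t) stateSet controlSet
  policies_measurable : ∀ π ∈ policies, ∀ t, Measurable (stateSet.domRestrict (π t))

namespace MPCData

variable {d m p : ℕ} (P : MPCData d m p)

/-- The trajectory `x_0, …, x_N` from `x` under the policy `π`, the disturbances `w` and the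
approximation errors `ζ`: `x_{t+1} = f (x_t, π_t x_t + ζ_t, w_t)` for `t < N`
(and constant after time `N`, which is never used). -/
def traj (π : Fin P.N → Eucl d → Eucl m) (w : Fin P.N → Eucl p) (ζ : Fin P.N → Eucl m)
    (x : Eucl d) : ℕ → Eucl d
  | 0 => x
  | t + 1 =>
    if h : t < P.N then
      P.field (traj π w ζ x t) (π ⟨t, h⟩ (traj π w ζ x t) + ζ ⟨t, h⟩) (w ⟨t, h⟩)
    else traj π w ζ x t

/-- `(w, ζ)` is an admissible realization of the uncertainty over the horizon. -/
def IsUncertainty (w : Fin P.N → Eucl p) (ζ : Fin P.N → Eucl m) : Prop :=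
  (∀ t, w t ∈ P.distSet) ∧ ∀ t, ζ t ∈ P.errSet

/-- The policy `π` is admissible and satisfies all the constraints from the initial state `x`,
whatever the uncertainty. -/
def IsFeasible (x : Eucl d) (π : Fin P.N → Eucl d → Eucl m) : Prop :=
  π ∈ P.policies ∧ ∀ w ζ, P.IsUncertainty w ζ →
    (∀ t : Fin P.N, P.traj π w ζ x t ∈ P.stateSet ∧
      π t (P.traj π w ζ x t) ∈ P.controlSet ∧
      π t (P.traj π w ζ x t) + ζ t ∈ P.controlSet) ∧
    P.traj π w ζ x P.N ∈ P.terminalSet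

/-- The worst-case cost of the policy `π` from the initial state `x`. -/
def worstCost (x : Eucl d) (π : Fin P.N → Eucl d → Eucl m) : ℝ≥0∞ :=
  ⨆ (w : Fin P.N → Eucl p) (ζ : Fin P.N → Eucl m) (_ : P.IsUncertainty w ζ),
    ((∑ t : Fin P.N, P.cost (P.traj π w ζ x t) (π t (P.traj π w ζ x t)) +
      P.finalCost (P.traj π w ζ x P.N) : ℝ≥0) : ℝ≥0∞)

/-- The policy `π` solves the min-max problem with initial state `x`. -/
def IsSolution (x : Eucl d) (π : Fin P.N → Eucl d → Eucl m) : Prop :=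
  P.IsFeasible x π ∧ ∀ π', P.IsFeasible x π' → P.worstCost x π ≤ P.worstCost x π'

/-- The set `X_N` of the feasible initial states for which the problem admits a solution. -/
def feasibleSet : Set (Eucl d) := {x | ∃ π, P.IsSolution x π}

/-- The first control that the policy `π` applies when it is started at `x`. -/
def firstControl (π : Fin P.N → Eucl d → Eucl m) (x : Eucl d) : Eucl m := π ⟨0, P.N_pos⟩ x

/-- `X_N` is nonempty and the problem is uniquely solvable at each of its points. Values of a policy
at states that are never visited do not enter the problem, so uniqueness is only required of the
first control; uniqueness of the solution as a policy is a special case. -/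
def UniquelySolvable : Prop :=
  P.feasibleSet.Nonempty ∧ ∀ x ∈ P.feasibleSet, ∀ π π', P.IsSolution x π → P.IsSolution x π' →
    P.firstControl π x = P.firstControl π' x

open Classical in
/-- The approximation-ready receding horizon policy `μ₀⋆ : X_N → ℝᵐ`: the first control of the
solution at `x` (and `0` outside `X_N`). -/
def rhPolicy (x : Eucl d) : Eucl m :=
  if h : ∃ π, P.IsSolution x π then P.firstControl h.choose x else 0

end MPCData

/-! ### Grids, extension and quasi-interpolation -/

/-- The point `k h` of the cardinal grid of step `h`, for `k ∈ ℤᵈ`. -/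
def gridPoint {d : ℕ} (h : ℝ) (k : Fin d → ℤ) : Eucl d := WithLp.toLp 2 fun i => (k i : ℝ) * h

/-- The cardinal grid `{k h : k ∈ ℤᵈ}`. -/
def grid (d : ℕ) (h : ℝ) : Set (Eucl d) := Set.range (gridPoint h)

/-- The grid points in the closed Euclidean ball around `x` of radius `Λ`. -/
def truncGrid {d : ℕ} (h : ℝ) (x : Eucl d) (Λ : ℝ) : Set (Eucl d) :=
  grid d h ∩ Metric.closedBall x Λ

theorem truncGrid_finite {d : ℕ} {h : ℝ} (hh : 0 < h) (x : Eucl d) (Λ : ℝ) :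
    (truncGrid h x Λ).Finite := by
  refine ((Set.finite_Icc (fun i => ⌊(x i - Λ) / h⌋) (fun i => ⌈(x i + Λ) / h⌉)).image
    (gridPoint h)).subset ?_
  rintro _ ⟨⟨k, rfl⟩, hk⟩
  refine ⟨k, ?_, rfl⟩
  have key : ∀ i, |(k i : ℝ) * h - x i| ≤ Λ := fun i => by
    have h1 := PiLp.norm_apply_le (gridPoint h k - x) i
    have h2 : ‖gridPoint h k - x‖ ≤ Λ := by simpa [dist_eq_norm] using hk
    simpa [gridPoint] using h1.trans h2
  constructor <;> intro i
  · have : (x i - Λ) / h ≤ k i := by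
      rw [div_le_iff₀ hh]; linarith [(abs_le.1 (key i)).1]
    exact Int.cast_le.1 ((Int.floor_le _).trans this : _ ≤ (k i : ℝ))
  · have : (k i : ℝ) ≤ (x i + Λ) / h := by
      rw [le_div_iff₀ hh]; linarith [(abs_le.1 (key i)).2]
    exact Int.cast_le.1 (this.trans (Int.le_ceil _))

/-- The component-wise Lipschitz extension
`x ↦ inf_{y ∈ S} (μ y + L ‖x - y‖)` to `ℝᵈ` of the restriction of `μ` to `S`. -/
def lipExt {d m : ℕ} (S : Set (Eucl d)) (L : ℝ≥0) (μ : Eucl d → Eucl m) (x : Eucl d) : Eucl m :=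
  WithLp.toLp 2 fun i => ⨅ y : S, (μ y i + L * ‖x - y‖)

/-- The continuous moment condition of order `M`: `∫ ψ = 1` and `∫ y^α ψ(y) dy = 0` for every
multi-index `α` with `1 ≤ [α] < M`. -/
def MomentCondition {d : ℕ} (M : ℕ) (ψ : 𝓢(Eucl d, ℝ)) : Prop :=
  ∫ y, ψ y = 1 ∧
    ∀ α : Fin d → ℕ, 1 ≤ ∑ i, α i → ∑ i, α i < M → ∫ y : Eucl d, (∏ i, y i ^ α i) * ψ y = 0

/-- The decay condition of exponent `K`: all the partial derivatives of `ψ` of order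
`n ≤ ⌊d/2⌋ + 1` are bounded by a multiple of `(1 + ‖x‖) ^ (-K)`. The partial derivative
`∂_{i₁} ⋯ ∂_{iₙ} ψ (x)` is the `n`-th derivative at `x`, evaluated at the unit vectors
`e_{i₁}, …, e_{iₙ}`. -/
def DecayCondition {d : ℕ} (K : ℝ) (ψ : 𝓢(Eucl d, ℝ)) : Prop :=
  (d : ℝ) < K ∧ ∃ C₀ : ℝ, 0 < C₀ ∧
    ∀ n : ℕ, n ≤ d / 2 + 1 → ∀ (i : Fin n → Fin d) (x : Eucl d),
      (1 + ‖x‖) ^ K *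
        |iteratedFDeriv ℝ n ψ x fun j => EuclideanSpace.single (i j) (1 : ℝ)| ≤ C₀

/-- The truncated quasi-interpolant
`x ↦ D^(-d/2) ∑_{y ∈ h ℤᵈ, ‖x - y‖ ≤ R₀ h} u(y) ψ((x - y) / (h √D))`;
the sum is finite for `h > 0`. -/
def truncQuasiInterp {d m : ℕ} (ψ : 𝓢(Eucl d, ℝ)) (h D R₀ : ℝ) (u : Eucl d → Eucl m)
    (x : Eucl d) : Eucl m :=
  D ^ (-(d : ℝ) / 2) •
    ∑ᶠ y ∈ truncGrid h x (R₀ * h), ψ ((h * Real.sqrt D)⁻¹ • (x - y)) • u y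

namespace MPCData

variable {d m p : ℕ} (P : MPCData d m p)

/-- The grid points of `X_N`, at which the problem has to be solved. -/
def net (h : ℝ) : Set (Eucl d) := P.feasibleSet ∩ grid d h

/-- The grid points of `X_N` form arbitrarily fine nets of `X_N`: for every `δ > 0` there is a
step `h < δ` such that each point of `X_N` is within `δ` of a grid point in `X_N`. -/
def HasGridNets : Prop :=
  ∀ δ : ℝ, 0 < δ → ∃ h : ℝ, 0 < h ∧ h < δ ∧ ∀ x ∈ P.feasibleSet, ∃ y ∈ P.net h, ‖x - y‖ ≤ δ

/-- The approximate feedback map `μ†`: the policy `μ₀⋆`, sampled at the grid points in `X_N`, is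
extended with the constant `L₀` to `ℝᵈ`, and the extension is quasi-interpolated. -/
def approxPolicy (L₀ : ℝ≥0) (ψ : 𝓢(Eucl d, ℝ)) (h D R₀ : ℝ) : Eucl d → Eucl m :=
  truncQuasiInterp ψ h D R₀ (lipExt (P.net h) L₀ P.rhPolicy)

end MPCData

end QuIFS

end

/-!
The error of the quasi-interpolant is usually split into a saturation error, made small by a large
`D`, a truncation error, made small by a large `R₀`, and a sampling error. A suitable generating
function removes the first two altogether, for `D = 1`.

On the line, the increment `β t = s (t + 1) - s t` of a smooth step `s` has integral `1`, is
supported in `[-1, 1]`, and its integer translates telescope to `1`; the same holds for its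
`L¹`-normalized dilates by positive integers. Since the `n`-th moment of the dilate by `a` is `a ^ n`
times that of `β`, a combination of the dilates by `1, …, M + 1` with the coefficients of polynomial
extrapolation to `0` has vanishing moments (`exists_kernel`) and keeps the partition of unity. The
tensor power of this kernel is a compactly supported generating function of order `M` on `ℝᵈ`, of any
decay exponent, whose lattice translates sum to exactly `1` (`exists_generatingFunction`). With `R₀`
beyond its support the truncation drops nothing, so the quasi-interpolant at `x` differs from
`μ₀⋆ x` by at most a constant times the largest `‖μ_E y - μ₀⋆ x‖` over the grid points `y` within
`R₀ h` of `x` (`norm_sub_truncQuasiInterp_le`). The Lipschitz bounds for `μ₀⋆` and its extension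
(`norm_sub_lipExt_le`) make this a multiple of the fineness `δ` of the net, since `h < δ`; the multiple
does not depend on `h`.

Membership in the control set costs nothing more: robust feasibility at time `0` says that
`μ₀⋆ x + ζ` is an admissible control for every `ζ` in a neighbourhood of the origin, so that any
vector close enough to `μ₀⋆ x`, uniformly in `x`, is one (`exists_control_margin`).
-/

open MeasureTheory
open scoped ContDiff

namespace QuIFS

/-! ### A one-dimensional kernel -/

/-- A smooth bump on `ℝ` supported in `[-1, 1]`, the increment of a smooth step, so that its integer
translates telescope to `1`. -/
noncomputable def stepBump (t : ℝ) : ℝ := Real.smoothTransition (t + 1) - Real.smoothTransition t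

theorem stepBump_contDiff : ContDiff ℝ ∞ stepBump := by
  have h : ContDiff ℝ ∞ Real.smoothTransition := Real.smoothTransition.contDiff
  exact (h.comp (contDiff_id.add contDiff_const)).sub h

theorem stepBump_eq_zero {t : ℝ} (ht : 1 ≤ |t|) : stepBump t = 0 := by
  rcases le_abs.1 ht with h | h
  · simp [stepBump, Real.smoothTransition.one_of_one_le h,
      Real.smoothTransition.one_of_one_le (show 1 ≤ t + 1 by linarith)]
  · simp [stepBump, Real.smoothTransition.zero_of_nonpos (show t ≤ 0 by linarith),
      Real.smoothTransition.zero_of_nonpos (show t + 1 ≤ 0 by linarith)]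

theorem hasCompactSupport_of_zero {b : ℝ → ℝ} {A : ℝ} (hb : ∀ t, A ≤ |t| → b t = 0) :
    HasCompactSupport b := by
  refine HasCompactSupport.intro (isCompact_closedBall (0 : ℝ) A) fun t ht => hb t ?_
  rw [mem_closedBall_zero_iff, Real.norm_eq_abs] at ht
  exact (not_le.1 ht).le

theorem integral_stepBump : ∫ t, stepBump t = 1 := by
  have hsub : Function.support stepBump ⊆ Set.Ioc (-1) 1 := by
    intro t ht
    by_contra h
    refine ht (stepBump_eq_zero ?_)
    rw [Set.mem_Ioc, not_and_or] at h
    rcases h with h | h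
    · exact le_abs.2 (Or.inr (by linarith))
    · exact le_abs.2 (Or.inl (by linarith))
  have hint (a b : ℝ) : IntervalIntegrable Real.smoothTransition volume a b :=
    Real.smoothTransition.continuous.intervalIntegrable a b
  have h0 : ∫ t in (-1 : ℝ)..0, Real.smoothTransition t = 0 := by
    rw [intervalIntegral.integral_congr (g := fun _ => 0)]
    · simp
    · intro t ht
      rw [Set.uIcc_of_le (by norm_num)] at ht
      exact Real.smoothTransition.zero_of_nonpos ht.2
  have h1 : ∫ t in (1 : ℝ)..2, Real.smoothTransition t = 1 := by
    rw [intervalIntegral.integral_congr (g := fun _ => 1)]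
    · norm_num
    · intro t ht
      rw [Set.uIcc_of_le (by norm_num)] at ht
      exact Real.smoothTransition.one_of_one_le ht.1
  have h2 : ∫ t in (-1 : ℝ)..1, Real.smoothTransition (t + 1) =
      ∫ t in (0 : ℝ)..2, Real.smoothTransition t := by
    rw [intervalIntegral.integral_comp_add_right]; norm_num
  rw [← intervalIntegral.integral_eq_integral_of_support_subset hsub]
  unfold stepBump
  rw [intervalIntegral.integral_sub _ (hint _ _), h2,
    ← intervalIntegral.integral_add_adjacent_intervals (hint (-1) 0) (hint 0 1),
    ← intervalIntegral.integral_add_adjacent_intervals (hint 0 1) (hint 1 2), h0, h1]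
  · ring
  · exact (Real.smoothTransition.continuous.comp
      (continuous_id.add continuous_const)).intervalIntegrable _ _

theorem integral_pow_mul_dilate (b : ℝ → ℝ) {a : ℝ} (ha : 0 < a) (n : ℕ) :
    ∫ t, t ^ n * (a⁻¹ * b (t / a)) = a ^ n * ∫ t, t ^ n * b t := by
  have h := Measure.integral_comp_div (fun t : ℝ => t ^ n * b t) a
  have e : ∀ t : ℝ, t ^ n * (a⁻¹ * b (t / a)) = a⁻¹ * a ^ n * ((t / a) ^ n * b (t / a)) := by
    intro t
    rw [div_pow]
    field_simp
  simp_rw [e]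
  rw [integral_const_mul, h, abs_of_pos ha, smul_eq_mul]
  field_simp

/-- Extrapolation to the origin from the nodes `1, …, n + 1`, exact in degrees up to `n`: the
coefficients are the values at `0` of the Lagrange basis. -/
theorem exists_extrapolation (n : ℕ) : ∃ c : ℕ → ℝ, ∀ k ≤ n,
    ∑ j ∈ Finset.range (n + 1), c j * ((j : ℝ) + 1) ^ k = if k = 0 then 1 else 0 := by
  set v : ℕ → ℝ := fun j => (j : ℝ) + 1
  refine ⟨fun j => (Lagrange.basis (Finset.range (n + 1)) v j).eval 0, fun k hk => ?_⟩
  have hv : Set.InjOn v (Finset.range (n + 1)) := fun i _ j _ hij => by simpa [v] using hij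
  have h := Lagrange.eq_interpolate (f := (Polynomial.X : Polynomial ℝ) ^ k) hv (by
    rw [Polynomial.degree_X_pow, Finset.card_range]
    exact_mod_cast Nat.lt_succ_of_le hk)
  have h' := congrArg (Polynomial.eval 0) h
  rw [Lagrange.interpolate_apply, Polynomial.eval_finsetSum] at h'
  simp only [Polynomial.eval_pow, Polynomial.eval_X, Polynomial.eval_mul, Polynomial.eval_C] at h'
  rw [← zero_pow_eq, h']
  exact Finset.sum_congr rfl fun j _ => mul_comm _ _

/-- The average of `a` dilated and shifted smooth steps. Its increment over a unit interval is the
dilate by `a` of `stepBump`, so integer translates of that dilate again telescope to `1`. -/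
noncomputable def avgStep (a : ℕ) (t : ℝ) : ℝ :=
  (a : ℝ)⁻¹ * ∑ i ∈ Finset.range a, Real.smoothTransition ((t + i) / a)

theorem avgStep_sub {a : ℕ} (ha : 0 < a) (t : ℝ) :
    avgStep a (t + 1) - avgStep a t = (a : ℝ)⁻¹ * stepBump (t / a) := by
  have ha' : (a : ℝ) ≠ 0 := by positivity
  have h := Finset.sum_range_sub (fun i : ℕ => Real.smoothTransition ((t + i) / a)) a
  rw [avgStep, avgStep, ← mul_sub, ← Finset.sum_sub_distrib, stepBump]
  congr 1
  simp only [Nat.cast_add, Nat.cast_one, Nat.cast_zero, add_zero, add_div, div_self ha'] at h ⊢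
  rw [← h]
  exact Finset.sum_congr rfl fun i _ => by ring_nf

theorem avgStep_eq_zero {a : ℕ} {t : ℝ} (ht : t ≤ -a) : avgStep a t = 0 := by
  refine mul_eq_zero_of_right _ (Finset.sum_eq_zero fun i hi => ?_)
  have hi' : (i : ℝ) < a := by exact_mod_cast Finset.mem_range.1 hi
  exact Real.smoothTransition.zero_of_nonpos
    (div_nonpos_of_nonpos_of_nonneg (by linarith) (by positivity))

theorem avgStep_eq_one {a : ℕ} (ha : 0 < a) {t : ℝ} (ht : a ≤ t) : avgStep a t = 1 := by
  have ha' : (0 : ℝ) < a := by exact_mod_cast ha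
  have h : ∀ i ∈ Finset.range a, Real.smoothTransition ((t + i) / a) = 1 := fun i _ =>
    Real.smoothTransition.one_of_one_le
      ((one_le_div ha').2 (by have : (0 : ℝ) ≤ i := i.cast_nonneg; linarith))
  rw [avgStep, Finset.sum_congr rfl h]
  simp [ha'.ne']

/-- On the line there are smooth compactly supported kernels with vanishing moments whose integer
translates sum to exactly `1`. The kernel is a combination, with extrapolation coefficients, of the
dilates of `stepBump` by `1, …, M + 1`; the sum runs over all the translates that do not vanish
at `t`. -/
theorem exists_kernel (M : ℕ) : ∃ (b : ℝ → ℝ) (A : ℕ), ContDiff ℝ ∞ b ∧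
    (∀ t, (A : ℝ) ≤ |t| → b t = 0) ∧
    (∀ n ≤ M, ∫ t, t ^ n * b t = if n = 0 then 1 else 0) ∧
    ∀ t : ℝ, ∑ j ∈ Finset.range (2 * A), b (t - ((⌊t⌋ - A + 1 + j : ℤ) : ℝ)) = 1 := by
  obtain ⟨c, hc⟩ := exists_extrapolation M
  set b : ℝ → ℝ := fun t => ∑ j ∈ Finset.range (M + 1),
    c j * (((j : ℝ) + 1)⁻¹ * stepBump (t / ((j : ℝ) + 1))) with hb
  set G : ℝ → ℝ := fun t => ∑ j ∈ Finset.range (M + 1), c j * avgStep (j + 1) t with hG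
  have hbG : ∀ t, b t = G (t + 1) - G t := fun t => by
    rw [hb, hG]
    simp only
    rw [← Finset.sum_sub_distrib]
    refine Finset.sum_congr rfl fun j _ => ?_
    rw [← mul_sub, avgStep_sub j.succ_pos]
    push_cast; rfl
  have hlt : ∀ j ∈ Finset.range (M + 1), ((j + 1 : ℕ) : ℝ) ≤ (M : ℝ) + 1 := fun j hj => by
    exact_mod_cast Finset.mem_range.1 hj
  have hG0 : ∀ t : ℝ, t ≤ -((M : ℝ) + 1) → G t = 0 := fun t ht =>
    Finset.sum_eq_zero fun j hj => by rw [avgStep_eq_zero (by linarith [hlt j hj]), mul_zero]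
  have hG1 : ∀ t : ℝ, (M : ℝ) + 1 ≤ t → G t = 1 := fun t ht => by
    have h := hc 0 M.zero_le
    rw [if_pos rfl] at h
    rw [← h]
    exact Finset.sum_congr rfl fun j hj => by
      rw [avgStep_eq_one j.succ_pos (by linarith [hlt j hj]), pow_zero]
  -- `G` is constant outside `[-(M + 1), M + 1]`, and an increment over a unit interval reaches one
  -- further.
  refine ⟨b, M + 2, ?_, ?_, ?_, ?_⟩
  · exact ContDiff.sum fun j _ => contDiff_const.mul
      (contDiff_const.mul (stepBump_contDiff.comp (contDiff_id.div_const _)))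
  · intro t ht
    push_cast at ht
    rw [hbG]
    rcases le_abs.1 ht with h | h
    · rw [hG1 t (by linarith), hG1 (t + 1) (by linarith), sub_self]
    · rw [hG0 t (by linarith), hG0 (t + 1) (by linarith), sub_self]
  · intro n hn
    have hi : ∀ j ∈ Finset.range (M + 1), Integrable fun t : ℝ =>
        t ^ n * (c j * (((j : ℝ) + 1)⁻¹ * stepBump (t / ((j : ℝ) + 1)))) := fun j _ => by
      have hj : (0 : ℝ) < (j : ℝ) + 1 := by positivity
      refine Continuous.integrable_of_hasCompactSupport ?_ ?_
      · have := stepBump_contDiff.continuous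
        fun_prop
      · refine hasCompactSupport_of_zero (A := (j : ℝ) + 1) fun t ht => ?_
        rw [stepBump_eq_zero, mul_zero, mul_zero, mul_zero]
        rwa [abs_div, abs_of_pos hj, one_le_div hj]
    have hm : ∀ j ∈ Finset.range (M + 1),
        ∫ t : ℝ, t ^ n * (c j * (((j : ℝ) + 1)⁻¹ * stepBump (t / ((j : ℝ) + 1)))) =
          (c j * ((j : ℝ) + 1) ^ n) * ∫ t, t ^ n * stepBump t := fun j _ => by
      have hj : (0 : ℝ) < (j : ℝ) + 1 := by positivity
      rw [mul_assoc, ← integral_pow_mul_dilate _ hj, ← integral_const_mul]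
      exact integral_congr_ae (Filter.Eventually.of_forall fun t => by ring)
    simp_rw [hb, Finset.mul_sum]
    rw [integral_finsetSum _ hi, Finset.sum_congr rfl hm, ← Finset.sum_mul, hc n hn]
    split_ifs with h
    · simp [h, integral_stepBump]
    · simp
  · intro t
    have h := Finset.sum_range_sub' (fun j : ℕ => G (t - ⌊t⌋ + (M + 2) - j)) (2 * (M + 2))
    have e : ∀ j ∈ Finset.range (2 * (M + 2)),
        b (t - ((⌊t⌋ - (M + 2 : ℕ) + 1 + j : ℤ) : ℝ)) =
          G (t - ⌊t⌋ + (M + 2) - j) - G (t - ⌊t⌋ + (M + 2) - (j + 1 : ℕ)) := fun j _ => by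
      rw [hbG]
      push_cast
      congr 2 <;> ring
    rw [Finset.sum_congr rfl e, h, hG1 _ _, hG0 _ _, sub_zero]
    · push_cast; linarith [Int.lt_floor_add_one t]
    · push_cast; linarith [Int.floor_le t]

/-! ### Generating functions forming a partition of unity -/

/-- Every Schwartz function satisfies the decay condition. -/
theorem decayCondition {d : ℕ} {K : ℝ} (hK : (d : ℝ) < K) (ψ : 𝓢(Eucl d, ℝ)) :
    DecayCondition K ψ := by
  set C := 2 ^ ⌈K⌉₊ *
    (Finset.Iic (⌈K⌉₊, d / 2 + 1)).sup (fun q => SchwartzMap.seminorm ℝ q.1 q.2) ψ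
  refine ⟨hK, max C 1, by positivity, fun n hn i x => le_max_of_le_left ?_⟩
  refine le_trans ?_ (SchwartzMap.one_add_le_sup_seminorm_apply (𝕜 := ℝ)
    (m := (⌈K⌉₊, d / 2 + 1)) le_rfl hn ψ x)
  rw [← Real.rpow_natCast]
  refine mul_le_mul (Real.rpow_le_rpow_of_exponent_le ?_ (Nat.le_ceil K)) ?_ (abs_nonneg _)
    (by positivity)
  · linarith [norm_nonneg x]
  · have h := (iteratedFDeriv ℝ n ψ x).le_opNorm fun j => EuclideanSpace.single (i j) (1 : ℝ)
    simpa using h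

theorem integral_prod_eucl {d : ℕ} (g : Fin d → ℝ → ℝ) :
    ∫ y : Eucl d, ∏ i, g i (y i) = ∏ i, ∫ t, g i t := by
  rw [← (PiLp.volume_preserving_toLp (Fin d)).integral_comp
    (MeasurableEquiv.toLp 2 _).measurableEmbedding]
  exact integral_fintype_prod_volume_eq_prod g

theorem norm_le_card_mul {m : ℕ} {v : Eucl m} {c : ℝ} (hc : 0 ≤ c) (hv : ∀ i, |v i| ≤ c) :
    ‖v‖ ≤ m * c := by
  rw [EuclideanSpace.norm_eq]
  refine Real.sqrt_le_iff.2 ⟨by positivity, ?_⟩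
  calc ∑ i, ‖v i‖ ^ 2 ≤ ∑ _i : Fin m, c ^ 2 :=
        Finset.sum_le_sum fun i _ => pow_le_pow_left₀ (norm_nonneg _) (hv i) 2
    _ = m * c ^ 2 := by simp
    _ ≤ (m * c) ^ 2 := by
        rw [mul_pow]
        refine mul_le_mul_of_nonneg_right ?_ (sq_nonneg c)
        exact_mod_cast Nat.le_self_pow two_ne_zero m

/-- The translates of `ψ` by the integer lattice form a (signed) partition of unity, supported in the
closed balls of radius `R`, with the sums of the absolute values bounded by `C`. At each point `t`
the finite set `s` holds all the translates that do not vanish at `t`. -/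
def IsLatticePartition {d : ℕ} (ψ : Eucl d → ℝ) (R C : ℝ) : Prop :=
  (∀ y, ψ y ≠ 0 → ‖y‖ ≤ R) ∧ ∀ t : Eucl d, ∃ s : Finset (Fin d → ℤ),
    (∀ k, ψ (t - gridPoint 1 k) ≠ 0 → k ∈ s) ∧ ∑ k ∈ s, ψ (t - gridPoint 1 k) = 1 ∧
    ∑ k ∈ s, |ψ (t - gridPoint 1 k)| ≤ C

/-- Tensor powers of the one-dimensional kernel inherit the vanishing moments and the partition of
unity. -/
theorem exists_generatingFunction (d M : ℕ) : ∃ (ψ : 𝓢(Eucl d, ℝ)) (R C : ℝ),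
    MomentCondition M ψ ∧ 0 < R ∧ 0 ≤ C ∧ IsLatticePartition ψ R C := by
  obtain ⟨b, A, hb, hb0, hbm, hb1⟩ := exists_kernel M
  obtain ⟨B, hB⟩ := hb.continuous.bounded_above_of_compact_support (hasCompactSupport_of_zero hb0)
  have hB0 : 0 ≤ B := (norm_nonneg _).trans (hB 0)
  have hsup : ∀ y : Eucl d, ∏ i, b (y i) ≠ 0 → ‖y‖ ≤ d * A + 1 := fun y hy => by
    have hi : ∀ i, |y i| ≤ A := fun i => by
      by_contra h
      exact hy (Finset.prod_eq_zero (Finset.mem_univ i) (hb0 _ (not_le.1 h).le))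
    linarith [norm_le_card_mul A.cast_nonneg hi]
  have hc : HasCompactSupport fun y : Eucl d => ∏ i, b (y i) :=
    HasCompactSupport.intro (isCompact_closedBall 0 (d * A + 1)) fun y hy => by
      by_contra h
      exact hy (mem_closedBall_zero_iff.2 (hsup y h))
  have hs : ContDiff ℝ ∞ fun y : Eucl d => ∏ i, b (y i) :=
    contDiff_prod fun i _ => hb.comp (contDiff_piLp_apply 2)
  refine ⟨hc.toSchwartzMap hs, d * A + 1, (2 * A) ^ d * B ^ d, ⟨?_, ?_⟩, by positivity,
    by positivity, hsup, fun t => ?_⟩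
  · have h := integral_prod_eucl fun (_ : Fin d) => b
    have h0 := hbm 0 M.zero_le
    simp only [pow_zero, one_mul, if_true] at h0
    rw [h0, Finset.prod_const_one] at h
    exact h
  · intro α h1 hM
    have h := integral_prod_eucl fun (i : Fin d) t => t ^ α i * b t
    have hle : ∀ i, α i ≤ M := fun i =>
      (Finset.single_le_sum (fun _ _ => Nat.zero_le _) (Finset.mem_univ i)).trans hM.le
    obtain ⟨i, hi⟩ : ∃ i, α i ≠ 0 := by
      by_contra! h
      simp [h] at h1
    rw [Finset.prod_eq_zero (Finset.mem_univ i) (by rw [hbm _ (hle i), if_neg hi])] at h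
    simp_rw [Finset.prod_mul_distrib] at h
    exact h
  · set κ : (Fin d → ℕ) → Fin d → ℤ := fun j i => ⌊t i⌋ - A + 1 + j i with hκ
    have hκi : Function.Injective κ := fun j j' h => funext fun i => by
      simpa [hκ] using congrFun h i
    refine ⟨(Fintype.piFinset fun _ => Finset.range (2 * A)).map ⟨κ, hκi⟩, ?_, ?_, ?_⟩
    · intro k hk
      have hi : ∀ i, |t i - k i| < A := fun i => by
        by_contra h
        refine hk (Finset.prod_eq_zero (Finset.mem_univ i) (hb0 _ ?_))
        simpa [gridPoint] using h
      have hlo : ∀ i, ⌊t i⌋ - A + 1 ≤ k i := fun i => by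
        have h1 := (abs_lt.1 (hi i)).2
        have h2 := Int.floor_le (t i)
        have : ((⌊t i⌋ : ℤ) : ℝ) < ((A + k i : ℤ) : ℝ) := by push_cast; linarith
        have := Int.cast_lt.1 this
        omega
      have hhi : ∀ i, k i < ⌊t i⌋ + A + 1 := fun i => by
        have h1 := (abs_lt.1 (hi i)).1
        have h2 := Int.lt_floor_add_one (t i)
        have : ((k i : ℤ) : ℝ) < ((⌊t i⌋ + A + 1 : ℤ) : ℝ) := by push_cast; linarith
        exact Int.cast_lt.1 this
      refine Finset.mem_map.2 ⟨fun i => (k i - (⌊t i⌋ - A + 1)).toNat, ?_, ?_⟩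
      · refine Fintype.mem_piFinset.2 fun i => Finset.mem_range.2 ?_
        have := hlo i
        have := hhi i
        omega
      · funext i
        have := hlo i
        simp only [hκ, Function.Embedding.coeFn_mk]
        omega
    · -- The product of the one-dimensional sums expands into the sum over the box.
      rw [Finset.sum_map]
      have h := Finset.prod_univ_sum (fun _ : Fin d => Finset.range (2 * A))
        fun i j => b (t i - ((⌊t i⌋ - A + 1 + j : ℤ) : ℝ))
      rw [Finset.prod_congr rfl fun i _ => hb1 (t i), Finset.prod_const_one] at h
      refine Eq.trans ?_ h.symm
      refine Finset.sum_congr rfl fun j _ => ?_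
      change ∏ i, b ((t - gridPoint 1 (κ j)) i) = _
      simp [gridPoint, hκ]
    · refine (Finset.sum_le_card_nsmul _ _ (B ^ d) fun k _ => ?_).trans ?_
      · have h := Finset.prod_le_prod (s := Finset.univ) (f := fun i : Fin d =>
          |b ((t - gridPoint 1 k) i)|) (g := fun _ => B) (fun _ _ => abs_nonneg _) fun i _ => hB _
        rw [← Finset.abs_prod] at h
        simpa using h
      · simp

/-! ### Quasi-interpolation and extension near a point -/

theorem gridPoint_injective {d : ℕ} {h : ℝ} (hh : h ≠ 0) :
    Function.Injective (gridPoint h : (Fin d → ℤ) → Eucl d) := fun k k' e => funext fun i => by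
  have := congrArg (fun v : Eucl d => v i) e
  simpa [gridPoint, hh] using this

/-- For a partition of unity the quasi-interpolant at `x`, with `D = 1`, is close to any vector `v`
that all the sampled values are close to. -/
theorem norm_sub_truncQuasiInterp_le {d m : ℕ} {ψ : 𝓢(Eucl d, ℝ)} {R C : ℝ}
    (hψ : IsLatticePartition ψ R C) {h : ℝ} (hh : 0 < h) {u : Eucl d → Eucl m} {x : Eucl d}
    {v : Eucl m} {η : ℝ} (hη : 0 ≤ η) (hu : ∀ y, ‖x - y‖ ≤ R * h → ‖v - u y‖ ≤ η) :
    ‖v - truncQuasiInterp ψ h 1 R u x‖ ≤ C * η := by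
  obtain ⟨hR, hpart⟩ := hψ
  obtain ⟨s, hs, hs1, hsC⟩ := hpart (h⁻¹ • x)
  have hx : ∀ k : Fin d → ℤ,
      (h * Real.sqrt 1)⁻¹ • (x - gridPoint h k) = h⁻¹ • x - gridPoint 1 k := fun k => by
    ext i
    simp [gridPoint]
    field_simp
  have hnorm : ∀ k : Fin d → ℤ, ψ (h⁻¹ • x - gridPoint 1 k) ≠ 0 → ‖x - gridPoint h k‖ ≤ R * h :=
    fun k hk => by
      have h1 := hR _ hk
      rw [← hx, norm_smul, Real.sqrt_one, mul_one, norm_inv, Real.norm_of_nonneg hh.le,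
        inv_mul_le_iff₀ hh] at h1
      linarith
  have hsum : truncQuasiInterp ψ h 1 R u x =
      ∑ k ∈ s, ψ (h⁻¹ • x - gridPoint 1 k) • u (gridPoint h k) := by
    rw [truncQuasiInterp, Real.one_rpow, one_smul,
      finsum_mem_eq_sum_of_inter_support_eq (t := s.map ⟨gridPoint h, gridPoint_injective hh.ne'⟩),
      Finset.sum_map]
    · simp only [Function.Embedding.coeFn_mk, hx]
    · ext y
      simp only [Set.mem_inter_iff, Function.mem_support, Finset.coe_map,
        Function.Embedding.coeFn_mk, and_congr_left_iff]
      intro hy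
      have hy' := left_ne_zero_of_smul hy
      constructor
      · rintro ⟨⟨k, rfl⟩, -⟩
        rw [hx] at hy'
        exact ⟨k, hs k hy', rfl⟩
      · rintro ⟨k, -, rfl⟩
        rw [hx] at hy'
        refine ⟨⟨k, rfl⟩, ?_⟩
        rw [Metric.mem_closedBall, dist_comm, dist_eq_norm]
        exact hnorm k hy'
  have hv : v = ∑ k ∈ s, ψ (h⁻¹ • x - gridPoint 1 k) • v := by
    rw [← Finset.sum_smul, hs1, one_smul]
  rw [hsum]
  nth_rewrite 1 [hv]
  rw [← Finset.sum_sub_distrib]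
  calc ‖∑ k ∈ s, (ψ (h⁻¹ • x - gridPoint 1 k) • v -
        ψ (h⁻¹ • x - gridPoint 1 k) • u (gridPoint h k))‖
      ≤ ∑ k ∈ s, |ψ (h⁻¹ • x - gridPoint 1 k)| * η := by
        refine norm_sum_le_of_le _ fun k _ => ?_
        rw [← smul_sub, norm_smul, Real.norm_eq_abs]
        by_cases hk : ψ (h⁻¹ • x - gridPoint 1 k) = 0
        · simp [hk]
        · exact mul_le_mul_of_nonneg_left (hu _ (hnorm k hk)) (abs_nonneg _)
    _ ≤ C * η := by
        rw [← Finset.sum_mul]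
        exact mul_le_mul_of_nonneg_right hsC hη

/-- The extension of a Lipschitz map stays close to the values of the map at nearby points. The
infimum is over a family bounded below, so it is not a junk value. -/
theorem norm_sub_lipExt_le {d m : ℕ} {S : Set (Eucl d)} {L : ℝ≥0} {μ : Eucl d → Eucl m}
    (hμ : LipschitzOnWith L μ S) {z : Eucl d} (hz : z ∈ S) (x : Eucl d) :
    ‖μ z - lipExt S L μ x‖ ≤ m * (L * ‖x - z‖) := by
  refine norm_le_card_mul (by positivity) fun i => ?_
  have hlow : ∀ y : S, μ z i - L * ‖x - z‖ ≤ μ y i + L * ‖x - y‖ := fun y => by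
    have h1 : |μ z i - μ y i| ≤ L * ‖z - y‖ := by
      have h := hμ.norm_sub_le hz y.2
      exact (PiLp.norm_apply_le (μ z - μ y) i).trans h
    have h2 : ‖z - y‖ ≤ ‖x - z‖ + ‖x - y‖ := by
      rw [norm_sub_rev x z]
      exact norm_sub_le_norm_sub_add_norm_sub z x y
    have h3 := mul_le_mul_of_nonneg_left h2 L.2
    have h4 := (abs_le.1 h1).2
    have h5 : (L : ℝ) * (‖x - z‖ + ‖x - y‖) = L * ‖x - z‖ + L * ‖x - y‖ := mul_add _ _ _
    change (L : ℝ) * _ ≤ L * _ at h3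
    linarith
  have : Nonempty S := ⟨⟨z, hz⟩⟩
  have hge : μ z i - L * ‖x - z‖ ≤ lipExt S L μ x i := le_ciInf hlow
  have hle : lipExt S L μ x i ≤ μ z i + L * ‖x - z‖ :=
    ciInf_le (f := fun y : S => μ y i + L * ‖x - y‖) ⟨_, Set.forall_mem_range.2 hlow⟩ ⟨z, hz⟩
  rw [PiLp.sub_apply, abs_le]
  constructor <;> linarith

/-! ### The control margin -/

namespace MPCData

variable {d m p : ℕ} (P : MPCData d m p)

/-- At the initial time the constraint `u₀ + ζ₀ ∈ 𝕌` has to hold for all the approximation errors. -/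
theorem rhPolicy_add_mem {x : Eucl d} (hx : x ∈ P.feasibleSet) {e : Eucl m} (he : e ∈ P.errSet) :
    P.rhPolicy x + e ∈ P.controlSet := by
  have hx' : ∃ π, P.IsSolution x π := hx
  have hfeas := hx'.choose_spec.1.2 (fun _ => 0) (fun _ => e)
    ⟨fun _ => interior_subset P.zero_mem_distSet, fun _ => he⟩
  have h := (hfeas.1 ⟨0, P.N_pos⟩).2.2
  rw [rhPolicy, dif_pos hx']
  exact h

theorem exists_control_margin : ∃ r : ℝ, 0 < r ∧ ∀ x ∈ P.feasibleSet, ∀ v,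
    ‖P.rhPolicy x - v‖ ≤ r → v ∈ P.controlSet := by
  obtain ⟨r, hr, hball⟩ := Metric.nhds_basis_closedBall.mem_iff.1
    (mem_interior_iff_mem_nhds.1 P.zero_mem_errSet)
  refine ⟨r, hr, fun x hx v hv => ?_⟩
  have h := P.rhPolicy_add_mem hx (e := v - P.rhPolicy x)
    (hball (mem_closedBall_zero_iff.2 (by rwa [norm_sub_rev])))
  rwa [add_sub_cancel] at h

end MPCData

end QuIFS

theorem theorem4p2 {d m p : ℕ} (P : QuIFS.MPCData d m p)
    (hP : P.UniquelySolvable) (hnet : P.HasGridNets)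
    (L₀ : ℝ≥0) (hL : LipschitzOnWith L₀ P.rhPolicy P.feasibleSet)
    (M : ℕ) (K : ℝ) (hK : (d : ℝ) < K) (ε : ℝ) (hε : 0 < ε) :
    ∃ (ψ : 𝓢(QuIFS.Eucl d, ℝ)) (h D R₀ : ℝ),
      QuIFS.MomentCondition M ψ ∧ QuIFS.DecayCondition K ψ ∧
      0 < h ∧ 0 < D ∧ 0 < R₀ ∧ (P.net h).Nonempty ∧
      ∀ x ∈ P.feasibleSet,
        ‖P.rhPolicy x - P.approxPolicy L₀ ψ h D R₀ x‖ ≤ ε ∧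
        P.approxPolicy L₀ ψ h D R₀ x ∈ P.controlSet := by
  obtain ⟨r, hr, hmargin⟩ := P.exists_control_margin
  obtain ⟨ψ, R, C, hmom, hR, hC, hψ⟩ := QuIFS.exists_generatingFunction d M
  -- For a net of fineness `δ` with `h < δ`, the error at each sample point is at most `B * δ`.
  set B : ℝ := L₀ + m * (L₀ * (R + 1)) with hB
  have hB0 : 0 ≤ B := by positivity
  have hCB : 0 < C * B + 1 := by positivity
  set δ : ℝ := min ε r / (C * B + 1) with hδ
  have hδ0 : 0 < δ := div_pos (lt_min hε hr) hCB
  obtain ⟨h, hh, hhδ, hcov⟩ := hnet δ hδ0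
  have herr : ∀ x ∈ P.feasibleSet, ‖P.rhPolicy x - P.approxPolicy L₀ ψ h 1 R x‖ ≤ min ε r := by
    intro x hx
    obtain ⟨z, hz, hxz⟩ := hcov x hx
    have hsample : ∀ y, ‖x - y‖ ≤ R * h →
        ‖P.rhPolicy x - QuIFS.lipExt (P.net h) L₀ P.rhPolicy y‖ ≤ B * δ := fun y hy => by
      have h1 : ‖P.rhPolicy x - P.rhPolicy z‖ ≤ L₀ * δ :=
        (hL.norm_sub_le hx hz.1).trans (by gcongr)
      have h2 := QuIFS.norm_sub_lipExt_le (hL.mono Set.inter_subset_left) hz y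
      have h3 : ‖y - z‖ ≤ (R + 1) * δ := by
        have h4 := norm_sub_le_norm_sub_add_norm_sub y x z
        rw [norm_sub_rev y x] at h4
        nlinarith
      calc _ ≤ _ := norm_sub_le_norm_sub_add_norm_sub _ (P.rhPolicy z) _
        _ ≤ L₀ * δ + m * (L₀ * ((R + 1) * δ)) := add_le_add h1 (h2.trans (by gcongr))
        _ = B * δ := by rw [hB]; ring
    refine (QuIFS.norm_sub_truncQuasiInterp_le hψ hh (by positivity) hsample).trans ?_
    calc C * (B * δ) ≤ (C * B + 1) * δ := by nlinarith
      _ = min ε r := by rw [hδ]; field_simp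
  obtain ⟨x₀, hx₀⟩ := hP.1
  obtain ⟨y₀, hy₀, -⟩ := hcov x₀ hx₀
  exact ⟨ψ, h, 1, R, hmom, QuIFS.decayCondition hK ψ, hh, one_pos, hR, ⟨y₀, hy₀⟩, fun x hx =>
    ⟨(herr x hx).trans (min_le_left _ _),
      hmargin x hx _ ((herr x hx).trans (min_le_right _ _))⟩⟩
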